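/- Let $w_0:[0,\infty)\to[0,\infty)$ be measurable and, for every integer $n\ge 1$, let $\mu=\mu_n$ be the rotation invariant measure $d\mu(x)=w_0(|x|)\,dx$ on $\mathbb R^n$ with the Euclidean distance; $B(x,R)$ denotes the open ball. A measure $\mu$ on $\mathbb R^n$ is *$n$-micro-doubling with constant $K_0>0$* if $\mu(B(x,(1+\frac1n)R))\le K_0\,\mu(B(x,R))$ for all $x$ and $R>0$; it is *weakly doubling with constant $K_1>0$* if $\mu(B(y,R))\le K_1\,\mu(B(x,R))$ for all $x,y$ and $R>0$ with $B(x,R)\cap B(y,R)\ne\emptyset$; it is *strong $n$-micro-doubling* if it is both. (1) Let $N\ge 1$ be an integer and suppose that, for every $n\ge N$, $\mu_n$ is a Radon measure that gives positive mass to every ball of positive radius. Then $\mu_n$ is strong $n$-micro-doubling in $\mathbb R^n$ for every $n\ge N$ with constants $K_0,K_1$ independent of $n$ if and only if $\mu_n$ is weakly doubling in $\mathbb R^n$ for every $n\ge N$ with a constant $K_1$ independent of $n$. (2) For each $\beta\ge 1$ there are an integer $N\ge 1$ and a constant $K>0$, depending only on $\beta$, with the following property. If $w(x)=w_0(|x|)$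 is essentially constant on dyadic annuli with constant $\beta$, i.e. for some $d\ge 1$ (the condition does not depend on $d$) $$\operatorname*{ess\,sup}_{x\in\mathbb R^d,\;R\le |x|\le 2R} w(x)\;\le\;\beta\,\operatorname*{ess\,inf}_{x\in\mathbb R^d,\;R\le |x|\le 2R} w(x)\qquad\text{for all }R>0,$$ then for every $n\ge N$ the measure $\mu_n$ is locally finite and $n$-micro-doubling on $\mathbb R^n$ with constant $K$. -/

import Mathlib

open MeasureTheory Metric
open scoped NNReal ENNReal

/-- The measure `dμ(x) = w₀(|x|) dx` on Euclidean space `ℝⁿ`, for a profile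
`w₀ : [0,∞) → [0,∞)`.  The same profile defines a measure in every dimension. -/
noncomputable def radialMeasure (w₀ : ℝ≥0 → ℝ≥0) (n : ℕ) :
    Measure (EuclideanSpace ℝ (Fin n)) :=
  (volume : Measure (EuclideanSpace ℝ (Fin n))).withDensity
    (fun x => ((w₀ ‖x‖₊ : ℝ≥0) : ℝ≥0∞))

/-- Standing requirements on a measure: it is locally finite (hence Radon, when the space is a
Euclidean space) and non-degenerate, i.e. every ball of positive radius has positive measure. -/
structure IsNondegenerateRadon {X : Type*} [MetricSpace X] [MeasurableSpace X]
    (μ : Measure X) : Prop where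
  locallyFinite : IsLocallyFiniteMeasure μ
  ball_pos : ∀ (x : X) (R : ℝ), 0 < R → 0 < μ (ball x R)

/-- `μ` is `ν`-micro-doubling with constant `K`. -/
def IsMicroDoubling {X : Type*} [MetricSpace X] [MeasurableSpace X]
    (ν : ℝ) (μ : Measure X) (K : ℝ≥0) : Prop :=
  ∀ (x : X) (R : ℝ), 0 < R → μ (ball x ((1 + 1 / ν) * R)) ≤ (K : ℝ≥0∞) * μ (ball x R)

/-- `μ` is weakly doubling with constant `K`: intersecting balls with the same radius have
comparable measures. -/
def IsWeaklyDoubling {X : Type*} [MetricSpace X] [MeasurableSpace X]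
    (μ : Measure X) (K : ℝ≥0) : Prop :=
  ∀ (x y : X) (R : ℝ), 0 < R → (ball x R ∩ ball y R).Nonempty →
    μ (ball y R) ≤ (K : ℝ≥0∞) * μ (ball x R)

/-- `μ` is strong `ν`-micro-doubling: it is both `ν`-micro-doubling (with constant `K₀`) and
weakly doubling (with constant `K₁`). -/
def IsStrongMicroDoubling {X : Type*} [MetricSpace X] [MeasurableSpace X]
    (ν : ℝ) (μ : Measure X) (K₀ K₁ : ℝ≥0) : Prop :=
  IsMicroDoubling ν μ K₀ ∧ IsWeaklyDoubling μ K₁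

/-- Weakly doubling in each `ℝⁿ`, `n ≥ N`, with a constant independent of `n`. -/
def UniformlyWeaklyDoubling (w₀ : ℝ≥0 → ℝ≥0) (N : ℕ) : Prop :=
  ∃ K₁ : ℝ≥0, 0 < K₁ ∧ ∀ n : ℕ, N ≤ n → IsWeaklyDoubling (radialMeasure w₀ n) K₁

/-- Strong `n`-micro-doubling in each `ℝⁿ`, `n ≥ N`, with constants independent of `n`. -/
def UniformlyStrongMicroDoubling (w₀ : ℝ≥0 → ℝ≥0) (N : ℕ) : Prop :=
  ∃ K₀ K₁ : ℝ≥0, 0 < K₀ ∧ 0 < K₁ ∧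
    ∀ n : ℕ, N ≤ n → IsStrongMicroDoubling (n : ℝ) (radialMeasure w₀ n) K₀ K₁

/-- The function `w(x) = w₀(|x|)` on `ℝᵈ` is essentially constant on dyadic annuli, with
constant `β`.  The essential bounds are with respect to Lebesgue measure on the annulus. -/
def EssConstOnDyadicAnnuli (d : ℕ) (w₀ : ℝ≥0 → ℝ≥0) (β : ℝ≥0) : Prop :=
  ∀ R : ℝ, 0 < R →
    essSup (fun x : EuclideanSpace ℝ (Fin d) => ((w₀ ‖x‖₊ : ℝ≥0) : ℝ≥0∞))
        (volume.restrict {x | R ≤ ‖x‖ ∧ ‖x‖ ≤ 2 * R}) ≤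
      (β : ℝ≥0∞) *
        essInf (fun x : EuclideanSpace ℝ (Fin d) => ((w₀ ‖x‖₊ : ℝ≥0) : ℝ≥0∞))
          (volume.restrict {x | R ≤ ‖x‖ ∧ ‖x‖ ≤ 2 * R})

/-! Both statements pass through one condition on the profile, `ComparableOn`: for almost all radii,
values at radii of ratio less than 2 agree up to a factor `C`.

Comparability gives micro-doubling with a constant free of the dimension. Dilating `ball x R` by `1
+ 1/n` about `x` costs a Jacobian at most `e` and moves points by less than `R/n`, so away from the
origin the density changes by at most `C`. Near the origin a shift of this size is not small
relative to the norm. There the volume growth `2 ^ n` beats `C`, so a centred ball has its mass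
concentrated in the outermost dyadic annulus, whose mass is dominated by that of a ball inside `ball
x R` (`ComparableOn.withDensity_norm_ball_le`). Profiles essentially constant on dyadic annuli are
comparable, which settles part (2).

For part (1), uniform weak doubling must imply comparability. On a unit ball whose centre has norm
`t`, the norm concentrates near `√(1 + t²)` as the dimension grows. Weak doubling for two such balls
on one axis, rescaled by `R`, therefore compares the profile at `R√(1 + t²)` and `R√(1 + t'²)`.
Since the profile is only measurable, one first averages over `R`, then lets the dimension tend to
infinity, and finally shrinks the averaging interval by Lebesgue differentiation
(`comparableOn_of_isWeaklyDoubling`). The finitely many dimensions too low for the first argument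
are handled by a covering argument. -/

/-! ### Dilations and almost every radius. -/

/-- The change of variables `y ↦ c + r • y` in `ℝⁿ`. -/
theorem setLIntegral_comp_add_smul {n : ℕ} (c : EuclideanSpace ℝ (Fin n)) {r : ℝ} (hr : 0 < r)
    {g : EuclideanSpace ℝ (Fin n) → ℝ≥0∞} (hg : Measurable g)
    {S : Set (EuclideanSpace ℝ (Fin n))} (hS : MeasurableSet S) :
    ∫⁻ y in S, g y =
      ENNReal.ofReal (r ^ n) * ∫⁻ y in (fun y => c + r • y) ⁻¹' S, g (c + r • y) := by
  have hm : Measurable (fun y : EuclideanSpace ℝ (Fin n) => c + r • y) := by fun_prop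
  have hmap : Measure.map (fun y : EuclideanSpace ℝ (Fin n) => c + r • y) volume =
      ENNReal.ofReal ((r ^ n)⁻¹) • (volume : Measure (EuclideanSpace ℝ (Fin n))) := by
    have h1 : (fun y : EuclideanSpace ℝ (Fin n) => c + r • y) =
        (fun z => c + z) ∘ (fun y => r • y) := rfl
    rw [h1, ← Measure.map_map (by fun_prop) (by fun_prop),
      Measure.map_addHaar_smul volume hr.ne', Measure.map_smul, map_add_left_eq_self,
      finrank_euclideanSpace_fin, abs_of_pos (by positivity)]
  rw [← setLIntegral_map hS hg hm, hmap, Measure.restrict_smul, lintegral_smul_measure,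
    smul_eq_mul, ← mul_assoc, ← ENNReal.ofReal_mul (by positivity),
    mul_inv_cancel₀ (by positivity), ENNReal.ofReal_one, one_mul]

/-- Comparability is used at a point and at its dilate together, so both norms must avoid the
exceptional radii almost everywhere. -/
theorem quasiMeasurePreserving_add_smul {n : ℕ} (c : EuclideanSpace ℝ (Fin n)) {r : ℝ}
    (hr : 0 < r) :
    Measure.QuasiMeasurePreserving (fun y : EuclideanSpace ℝ (Fin n) => c + r • y)
      volume volume := by
  refine ⟨by fun_prop, Measure.AbsolutelyContinuous.mk fun S hS h0 => ?_⟩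
  have h := setLIntegral_comp_add_smul c hr (g := fun _ => 1) measurable_const hS
  rw [Measure.map_apply (by fun_prop) hS]
  simp only [lintegral_const, one_mul, Measure.restrict_apply_univ, h0] at h
  rcases mul_eq_zero.mp h.symm with h' | h'
  · rw [ENNReal.ofReal_eq_zero] at h'
    exact absurd h' (not_le.mpr (by positivity))
  · exact h'

/-- A property of the norm holds almost everywhere in `ℝⁿ` iff it holds at almost every radius. -/
theorem ae_norm_mem_iff {n : ℕ} (hn : 1 ≤ n) {S : Set ℝ} (hS : MeasurableSet S) :
    (∀ᵐ x : EuclideanSpace ℝ (Fin n), ‖x‖ ∈ S) ↔ ∀ᵐ r : ℝ, 0 < r → r ∈ S := by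
  have : Nonempty (Fin n) := ⟨⟨0, hn⟩⟩
  set μ : Measure (EuclideanSpace ℝ (Fin n)) := volume
  -- Polar coordinates equate, up to a positive factor, the integral of this indicator over the
  -- space with its integral against `r ^ (n - 1)`, a weight that is positive for `r > 0`.
  -- Integrability is transferred as well, since a Bochner integral may vanish for want of it.
  set f : ℝ → ℝ := Sᶜ.indicator 1 with hf
  have hfm : Measurable f := measurable_one.indicator hS.compl
  have hf0 : ∀ r, 0 ≤ f r := fun r => Set.indicator_nonneg (fun _ _ => zero_le_one) r
  have hfz : ∀ r, f r = 0 ↔ r ∈ S := fun r => by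
    by_cases h : r ∈ S <;> simp [hf, h]
  have hint := integral_fun_norm_addHaar μ f
  have hiff := integrable_fun_norm_addHaar μ (f := f)
  have hR : (∀ᵐ r : ℝ, 0 < r → r ∈ S) ↔
      (fun y : ℝ => y ^ (Module.finrank ℝ (EuclideanSpace ℝ (Fin n)) - 1) • f y)
        =ᵐ[volume.restrict (Set.Ioi 0)] 0 := by
    rw [Filter.EventuallyEq, ae_restrict_iff' measurableSet_Ioi]
    refine Filter.eventually_congr (Filter.Eventually.of_forall fun r => ?_)
    refine forall_congr' fun hr => ?_
    have : r ^ (Module.finrank ℝ (EuclideanSpace ℝ (Fin n)) - 1) ≠ 0 :=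
      pow_ne_zero _ (Set.mem_Ioi.mp hr).ne'
    rw [Pi.zero_apply, smul_eq_zero, hfz]
    exact ⟨Or.inr, fun h => h.resolve_left this⟩
  have hL : (∀ᵐ x : EuclideanSpace ℝ (Fin n), ‖x‖ ∈ S) ↔ (fun x => f ‖x‖) =ᵐ[μ] 0 :=
    Filter.eventually_congr (Filter.Eventually.of_forall fun x => by simp [hfz])
  have hpos : 0 ≤ᵐ[volume.restrict (Set.Ioi (0:ℝ))]
      (fun y : ℝ => y ^ (Module.finrank ℝ (EuclideanSpace ℝ (Fin n)) - 1) • f y) := by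
    filter_upwards [ae_restrict_mem measurableSet_Ioi] with r hr
    exact mul_nonneg (pow_nonneg (Set.mem_Ioi.mp hr).le _) (hf0 r)
  rw [hR, hL]
  constructor
  · intro h
    have hI : Integrable (fun x => f ‖x‖) μ := (integrable_zero _ _ _).congr h.symm
    have h0 : ∫ x, f ‖x‖ ∂μ = 0 := by rw [integral_congr_ae h]; simp
    rw [h0] at hint
    have hd : Module.finrank ℝ (EuclideanSpace ℝ (Fin n)) ≠ 0 := by
      rw [finrank_euclideanSpace_fin]; omega
    have hb : μ.real (ball 0 1) ≠ 0 :=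
      (ENNReal.toReal_pos (measure_ball_pos μ _ one_pos).ne' measure_ball_lt_top.ne).ne'
    have h1 : ∫ y in Set.Ioi (0:ℝ),
        y ^ (Module.finrank ℝ (EuclideanSpace ℝ (Fin n)) - 1) • f y = 0 := by
      rcases smul_eq_zero.mp hint.symm with h2 | h2
      · exact absurd h2 hd
      · exact (smul_eq_zero.mp h2).resolve_left hb
    exact (integral_eq_zero_iff_of_nonneg_ae hpos (hiff.mp hI)).mp h1
  · intro h
    have hI : Integrable (fun x => f ‖x‖) μ := hiff.mpr ((integrable_zero _ _ _).congr h.symm)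
    rw [integral_congr_ae h] at hint
    simp only [Pi.zero_apply, integral_zero, smul_zero] at hint
    exact (integral_eq_zero_iff_of_nonneg (fun x => hf0 _) hI).mp hint

theorem ae_norm_mem {n : ℕ} (hn : 1 ≤ n) {L : Set ℝ} (hL : ∀ᵐ r : ℝ, 0 < r → r ∈ L) :
    ∀ᵐ x : EuclideanSpace ℝ (Fin n), ‖x‖ ∈ L := by
  obtain ⟨S, hS, hSm, hSL⟩ := Filter.Eventually.exists_measurable_mem hL
  have h1 := (ae_norm_mem_iff hn hSm).mpr (Filter.mem_of_superset hS fun r hr _ => hr)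
  have h2 : ∀ᵐ x : EuclideanSpace ℝ (Fin n), ‖x‖ ∈ Set.Ioi (0:ℝ) :=
    (ae_norm_mem_iff hn measurableSet_Ioi).mpr (Filter.Eventually.of_forall fun r hr => hr)
  filter_upwards [h1, h2] with x hx hx0 using hSL _ hx hx0

theorem exists_mem_Ioo_of_ae {L : Set ℝ} (hL : ∀ᵐ r : ℝ, 0 < r → r ∈ L) {a b : ℝ} (ha : 0 ≤ a)
    (hab : a < b) : ∃ q ∈ L, a < q ∧ q < b := by
  by_contra! hcon
  have h0 : volume (Set.Ioo a b) = 0 := by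
    refine measure_mono_null (fun q hq => ?_) hL
    simp only [Set.mem_compl_iff, Set.mem_ofPred_eq, Classical.not_imp]
    exact ⟨ha.trans_lt hq.1, fun hqL => absurd hq.2 (not_lt.mpr (hcon q hqL hq.1))⟩
  simp only [Real.volume_Ioo, ENNReal.ofReal_eq_zero] at h0
  linarith

/-! ### Comparable profiles are micro-doubling in high dimension. -/

/-- The values of `f` at radii in `L` whose ratio is less than `κ` are comparable up to `C`. -/
def ComparableOn (L : Set ℝ) (κ : ℝ) (f : ℝ → ℝ≥0∞) (C : ℝ≥0∞) : Prop :=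
  ∀ r ∈ L, ∀ s ∈ L, 0 < r → 0 < s → r < κ * s → s < κ * r → f s ≤ C * f r

/-- Two radii of ratio below `κ ^ 2` are linked through an intermediate radius within `κ` of both;
such radii fill a nontrivial interval, so one of them lies in `L`. -/
theorem ComparableOn.sq {L : Set ℝ} (hL : ∀ᵐ r : ℝ, 0 < r → r ∈ L) {κ : ℝ} (hκ : 1 < κ)
    {f : ℝ → ℝ≥0∞} {C : ℝ≥0∞} (h : ComparableOn L κ f C) :
    ComparableOn L (κ ^ 2) f (C ^ 2) := by
  intro r hr s hs hr0 hs0 hrs hsr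
  have hκ0 : 0 < κ := by linarith
  have key : max r s / κ < κ * min r s := by
    rw [div_lt_iff₀ hκ0]
    rcases le_total r s with h' | h'
    · rw [max_eq_right h', min_eq_left h']; nlinarith
    · rw [max_eq_left h', min_eq_right h']; nlinarith
  obtain ⟨q, hq, h1, h2⟩ := exists_mem_Ioo_of_ae hL (by positivity) key
  have hq0 : 0 < q := lt_of_le_of_lt (by positivity) h1
  rw [div_lt_iff₀ hκ0] at h1
  have hr1 : r < κ * q := by linarith [le_max_left r s]
  have hs1 : s < κ * q := by linarith [le_max_right r s]
  have hr2 : q < κ * r := by nlinarith [min_le_left r s]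
  have hs2 : q < κ * s := by nlinarith [min_le_right r s]
  calc f s ≤ C * f q := h q hq s hs hq0 hs0 hs2 hs1
    _ ≤ C * (C * f r) := by gcongr; exact h r hr q hq hr0 hq0 hr1 hr2
    _ = C ^ 2 * f r := by ring

/-- Mass of a ball centred at the origin is controlled by its outermost dyadic annulus. -/
theorem withDensity_norm_ball_zero_le {n : ℕ} (hn : 1 ≤ n) {L : Set ℝ}
    (hL : ∀ᵐ r : ℝ, 0 < r → r ∈ L) {f : ℝ → ℝ≥0∞} (hf : Measurable f) {C : ℝ≥0∞}
    (hC : ComparableOn L 4 f C) (hCn : 2 * C ≤ 2 ^ n) {ρ : ℝ} (hρ : 0 < ρ) :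
    (volume.withDensity fun x : EuclideanSpace ℝ (Fin n) => f ‖x‖) (ball 0 ρ) ≤
      2 * (volume.withDensity fun x : EuclideanSpace ℝ (Fin n) => f ‖x‖)
        {x | ρ / 2 ≤ ‖x‖ ∧ ‖x‖ < ρ} := by
  have : Nonempty (Fin n) := ⟨⟨0, hn⟩⟩
  set μ := volume.withDensity fun x : EuclideanSpace ℝ (Fin n) => f ‖x‖ with hμ
  have hgm : Measurable fun x : EuclideanSpace ℝ (Fin n) => f ‖x‖ := hf.comp measurable_norm
  set A : ℕ → Set (EuclideanSpace ℝ (Fin n)) :=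
    fun j => {x | ρ / 2 ^ (j + 1) ≤ ‖x‖ ∧ ‖x‖ < ρ / 2 ^ j} with hA
  have hAm : ∀ j, MeasurableSet (A j) := fun j =>
    (measurableSet_le measurable_const measurable_norm).inter
      (measurableSet_lt measurable_norm measurable_const)
  have hhalf : ENNReal.ofReal ((1 / 2 : ℝ) ^ n) * C ≤ 2⁻¹ := by
    rw [ENNReal.ofReal_pow (by norm_num), one_div, ENNReal.ofReal_inv_of_pos (by norm_num),
      ENNReal.ofReal_ofNat, ENNReal.inv_pow.symm, mul_comm, ← div_eq_mul_inv]
    refine ENNReal.div_le_of_le_mul ?_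
    rw [← ENNReal.div_eq_inv_mul, ENNReal.le_div_iff_mul_le (by simp) (by simp), mul_comm]
    exact hCn
  -- Halving the radius costs `2 ^ (-n)` in volume and gains at most `C` in density. The ratio is
  -- exactly 2, which the strict inequalities of comparability at 2 would exclude; hence the
  -- hypothesis at 4.
  have hstep : ∀ j, μ (A (j + 1)) ≤ 2⁻¹ * μ (A j) := by
    intro j
    rw [hμ, withDensity_apply _ (hAm _), withDensity_apply _ (hAm _),
      setLIntegral_comp_add_smul 0 (r := 1 / 2) (by norm_num) hgm (hAm _)]
    have hpre : (fun y : EuclideanSpace ℝ (Fin n) => 0 + (1 / 2 : ℝ) • y) ⁻¹' A (j + 1) = A j := by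
      ext y
      simp only [hA, Set.mem_preimage, Set.mem_ofPred_eq, zero_add, norm_smul, Real.norm_eq_abs,
        abs_of_pos (show (0:ℝ) < 1 / 2 by norm_num)]
      have h1 : ρ / 2 ^ (j + 1 + 1) = 1 / 2 * (ρ / 2 ^ (j + 1)) := by
        field_simp; ring
      have h2 : ρ / 2 ^ (j + 1) = 1 / 2 * (ρ / 2 ^ j) := by
        field_simp; ring
      rw [h1, mul_le_mul_iff_right₀ (by norm_num), h2, mul_lt_mul_iff_right₀ (by norm_num)]
    rw [hpre]
    have hae : ∀ᵐ y : EuclideanSpace ℝ (Fin n), y ∈ A j →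
        f ‖(0 : EuclideanSpace ℝ (Fin n)) + (1 / 2 : ℝ) • y‖ ≤ C * f ‖y‖ := by
      filter_upwards [ae_norm_mem hn hL, (quasiMeasurePreserving_add_smul
        (0 : EuclideanSpace ℝ (Fin n)) (r := 1 / 2) (by norm_num)).ae (ae_norm_mem hn hL)]
        with y h1 h2 hy
      have hy0 : 0 < ‖y‖ := lt_of_lt_of_le (by positivity) hy.1
      have he : ‖(0 : EuclideanSpace ℝ (Fin n)) + (1 / 2 : ℝ) • y‖ = 1 / 2 * ‖y‖ := by
        simp [norm_smul]
      rw [he] at h2 ⊢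
      exact hC _ h1 _ h2 hy0 (by positivity) (by linarith) (by linarith)
    calc _ ≤ ENNReal.ofReal ((1 / 2 : ℝ) ^ n) * ∫⁻ y in A j, C * f ‖y‖ := by
            gcongr 1
            exact setLIntegral_mono_ae (hgm.const_mul _).aemeasurable hae
      _ = (ENNReal.ofReal ((1 / 2 : ℝ) ^ n) * C) * ∫⁻ y in A j, f ‖y‖ := by
            rw [lintegral_const_mul _ hgm, mul_assoc]
      _ ≤ _ := by gcongr
  have hdec : ∀ j, μ (A j) ≤ 2⁻¹ ^ j * μ (A 0) := by
    intro j
    induction j with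
    | zero => simp
    | succ j ih =>
      calc _ ≤ 2⁻¹ * μ (A j) := hstep j
        _ ≤ 2⁻¹ * (2⁻¹ ^ j * μ (A 0)) := by gcongr
        _ = _ := by ring
  have hcov : ball (0 : EuclideanSpace ℝ (Fin n)) ρ ⊆ {0} ∪ ⋃ j, A j := by
    intro x hx
    rw [mem_ball_zero_iff] at hx
    rcases eq_or_ne x 0 with h0 | h0
    · exact Or.inl h0
    · right
      have hx0 : 0 < ‖x‖ := norm_pos_iff.mpr h0
      obtain ⟨j, h1, h2⟩ := exists_nat_pow_near (x := ρ / ‖x‖) (y := 2)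
        (by rw [le_div_iff₀ hx0]; linarith) (by norm_num)
      -- The annuli contain their inner sphere and not their outer one, so a norm equal to `ρ / 2 ^
      -- j` belongs to the annulus of index `j - 1`.
      obtain h1 | h1 := h1.lt_or_eq
      · refine Set.mem_iUnion.mpr ⟨j, ?_, ?_⟩
        · rw [div_le_iff₀ (by positivity), mul_comm]
          rw [div_lt_iff₀ hx0] at h2; exact h2.le
        · rw [lt_div_iff₀ (by positivity), mul_comm]
          rw [lt_div_iff₀ hx0] at h1; exact h1
      · rcases j with _ | j
        · exfalso
          rw [pow_zero, eq_comm, div_eq_iff hx0.ne'] at h1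
          linarith
        · refine Set.mem_iUnion.mpr ⟨j, ?_, ?_⟩
          · rw [h1]; field_simp; exact le_refl _
          · have h3 : ‖x‖ * 2 ^ (j + 1) = ρ := by rw [h1]; field_simp
            rw [lt_div_iff₀ (by positivity), ← h3, pow_succ]
            have : 0 < ‖x‖ * 2 ^ j := by positivity
            linarith
  have h0 : μ {0} = 0 := by
    rw [hμ]
    exact withDensity_absolutelyContinuous _ _ (measure_singleton 0)
  have hA0 : A 0 = {x | ρ / 2 ≤ ‖x‖ ∧ ‖x‖ < ρ} := by simp [hA]
  calc μ (ball 0 ρ) ≤ μ ({0} ∪ ⋃ j, A j) := measure_mono hcov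
    _ ≤ μ {0} + μ (⋃ j, A j) := measure_union_le _ _
    _ ≤ 0 + ∑' j, μ (A j) := by rw [h0]; gcongr; exact measure_iUnion_le _
    _ ≤ ∑' j, 2⁻¹ ^ j * μ (A 0) := by rw [zero_add]; exact ENNReal.tsum_le_tsum hdec
    _ = 2 * μ (A 0) := by
      rw [ENNReal.tsum_mul_right, ENNReal.tsum_geometric, ENNReal.one_sub_inv_two, inv_inv]
    _ = _ := by rw [hA0]

/-- At least half the mass lies in the annulus from `R / 8` to `R / 4`, whose radii are within a
factor 16 of the reference radius `p`; two squarings of comparability give `C ^ 4`. -/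
theorem withDensity_norm_ball_zero_le_volume {n : ℕ} (hn : 1 ≤ n) {L : Set ℝ}
    (hL : ∀ᵐ r : ℝ, 0 < r → r ∈ L) {f : ℝ → ℝ≥0∞} (hf : Measurable f) {C : ℝ≥0∞}
    (hC : ComparableOn L 2 f C) (hCn : 2 * C ^ 2 ≤ 2 ^ n) {R p : ℝ} (hR : 0 < R) (hpL : p ∈ L)
    (hp1 : 3 * R / 4 < p) (hp2 : p < R) :
    (volume.withDensity fun x : EuclideanSpace ℝ (Fin n) => f ‖x‖) (ball 0 (R / 4)) ≤
      2 * C ^ 4 * (f p * volume (ball (0 : EuclideanSpace ℝ (Fin n)) (R / 4))) := by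
  have hC4 : ComparableOn L 4 f (C ^ 2) := by
    convert hC.sq hL (by norm_num) using 1; norm_num
  have hC16 : ComparableOn L 16 f (C ^ 4) := by
    convert hC4.sq hL (by norm_num) using 1
    · norm_num
    · ring
  refine (withDensity_norm_ball_zero_le hn hL hf hC4 hCn (by positivity)).trans ?_
  rw [mul_assoc]
  gcongr 2 * ?_
  have hAm : MeasurableSet {x : EuclideanSpace ℝ (Fin n) | R / 4 / 2 ≤ ‖x‖ ∧ ‖x‖ < R / 4} :=
    (measurableSet_le measurable_const measurable_norm).inter
      (measurableSet_lt measurable_norm measurable_const)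
  rw [withDensity_apply _ hAm]
  calc _ ≤ ∫⁻ _ in {x : EuclideanSpace ℝ (Fin n) | R / 4 / 2 ≤ ‖x‖ ∧ ‖x‖ < R / 4},
        C ^ 4 * f p := by
        refine setLIntegral_mono_ae aemeasurable_const ?_
        filter_upwards [ae_norm_mem hn hL] with x hx hxA
        obtain ⟨h1, h2⟩ := hxA
        exact hC16 _ hpL _ hx (by linarith) (by linarith) (by linarith) (by linarith)
    _ ≤ C ^ 4 * f p * volume (ball (0 : EuclideanSpace ℝ (Fin n)) (R / 4)) := by
        rw [setLIntegral_const]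
        gcongr
        intro x hx
        exact mem_ball_zero_iff.mpr hx.2
    _ = _ := by ring

theorem ComparableOn.isLocallyFiniteMeasure {n : ℕ} (hn : 1 ≤ n) {L : Set ℝ}
    (hL : ∀ᵐ r : ℝ, 0 < r → r ∈ L) {f : ℝ → ℝ≥0∞} (hf : Measurable f) (hf' : ∀ r, f r ≠ ∞)
    {C : ℝ≥0∞} (hCt : C ≠ ∞) (hC : ComparableOn L 2 f C) (hCn : 2 * C ^ 2 ≤ 2 ^ n) :
    IsLocallyFiniteMeasure (volume.withDensity fun x : EuclideanSpace ℝ (Fin n) => f ‖x‖) := by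
  refine ⟨fun x => ⟨ball 0 (‖x‖ + 1), isOpen_ball.mem_nhds (by simp), ?_⟩⟩
  set R := 4 * (‖x‖ + 1) with hR
  have hR0 : 0 < R := by positivity
  obtain ⟨p, hpL, hp1, hp2⟩ := exists_mem_Ioo_of_ae hL (a := 3 * R / 4) (b := R)
    (by positivity) (by linarith)
  have h := withDensity_norm_ball_zero_le_volume hn hL hf hC hCn hR0 hpL hp1 hp2
  rw [show R / 4 = ‖x‖ + 1 by rw [hR]; ring] at h
  refine h.trans_lt (ENNReal.mul_lt_top (ENNReal.mul_lt_top (by simp) ?_) (ENNReal.mul_lt_top ?_ ?_))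
  · exact ENNReal.pow_lt_top hCt.lt_top
  · exact (hf' p).lt_top
  · exact measure_ball_lt_top

theorem withDensity_norm_ball_zero_le_ball {n : ℕ} (hn : 1 ≤ n) {L : Set ℝ}
    (hL : ∀ᵐ r : ℝ, 0 < r → r ∈ L) {f : ℝ → ℝ≥0∞} (hf : Measurable f) {C : ℝ≥0∞}
    (hC : ComparableOn L 2 f C) (hCn : 2 * C ^ 2 ≤ 2 ^ n) {R : ℝ} (hR : 0 < R)
    {x : EuclideanSpace ℝ (Fin n)} (hx : ‖x‖ < 2 * R) :
    (volume.withDensity fun x : EuclideanSpace ℝ (Fin n) => f ‖x‖) (ball 0 (R / 4)) ≤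
      2 * C ^ 6 * (volume.withDensity fun x : EuclideanSpace ℝ (Fin n) => f ‖x‖) (ball x R) := by
  have : Nonempty (Fin n) := ⟨⟨0, hn⟩⟩
  -- Below, the norms on `ball z (R / 4)` lie between `R / 4` and `11 R / 4`. This window for `p`
  -- keeps both ratios under 4, at the cost of a factor `C ^ 2`.
  obtain ⟨p, hpL, hp1, hp2⟩ := exists_mem_Ioo_of_ae hL (a := 3 * R / 4) (b := R)
    (by positivity) (by linarith)
  have hC4 : ComparableOn L 4 f (C ^ 2) := by
    convert hC.sq hL (by norm_num) using 1; norm_num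
  have hgm : Measurable fun x : EuclideanSpace ℝ (Fin n) => f ‖x‖ := hf.comp measurable_norm
  -- Pushing `x` outward by `R / 2` leaves room for a ball of radius `R / 4` that is inside `ball x
  -- R` and away from the origin.
  obtain ⟨z, hzx, hz⟩ : ∃ z : EuclideanSpace ℝ (Fin n), dist z x = R / 2 ∧ R / 2 ≤ ‖z‖ := by
    rcases eq_or_ne x 0 with h0 | h0
    · obtain ⟨z, hz⟩ := exists_norm_eq (EuclideanSpace ℝ (Fin n)) (c := R / 2) (by positivity)
      exact ⟨z, by simp [h0, hz], hz.ge⟩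
    · have hx0 : 0 < ‖x‖ := norm_pos_iff.mpr h0
      refine ⟨(1 + R / 2 / ‖x‖) • x, ?_, ?_⟩
      · rw [add_smul, one_smul, dist_eq_norm, add_sub_cancel_left, norm_smul, Real.norm_eq_abs,
          abs_of_pos (by positivity), div_mul_cancel₀ _ hx0.ne']
      · rw [norm_smul, Real.norm_eq_abs, abs_of_pos (by positivity), add_mul,
          div_mul_cancel₀ _ hx0.ne']
        linarith
  have hlow : f p * volume (ball (0 : EuclideanSpace ℝ (Fin n)) (R / 4)) ≤
      C ^ 2 * (volume.withDensity fun x : EuclideanSpace ℝ (Fin n) => f ‖x‖) (ball x R) := by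
    rw [← Measure.addHaar_ball_center volume z, ← setLIntegral_const,
      withDensity_apply _ measurableSet_ball, ← lintegral_const_mul _ hgm]
    calc _ ≤ ∫⁻ y in ball z (R / 4), C ^ 2 * f ‖y‖ := by
          refine setLIntegral_mono_ae (hgm.const_mul _).aemeasurable ?_
          filter_upwards [ae_norm_mem hn hL] with y hy hyz
          rw [mem_ball] at hyz
          have h1 : ‖y‖ ≤ dist y z + dist z x + ‖x‖ := by
            have := dist_triangle4 y z x 0
            simpa using this
          have h2 : ‖z‖ ≤ dist y z + ‖y‖ := by
            have := dist_triangle z y 0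
            simpa [dist_comm] using this
          exact hC4 _ hy _ hpL (by linarith) (by linarith) (by linarith) (by linarith)
      _ ≤ _ := by
          refine lintegral_mono_set (ball_subset_ball' ?_)
          linarith
  calc _ ≤ 2 * C ^ 4 * (f p * volume (ball (0 : EuclideanSpace ℝ (Fin n)) (R / 4))) :=
        withDensity_norm_ball_zero_le_volume hn hL hf hC hCn hR hpL hp1 hp2
    _ ≤ 2 * C ^ 4 * (C ^ 2 * _) := by gcongr
    _ = _ := by ring

theorem ComparableOn.withDensity_norm_ball_le {n : ℕ} (hn : 16 ≤ n) {L : Set ℝ}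
    (hL : ∀ᵐ r : ℝ, 0 < r → r ∈ L) {f : ℝ → ℝ≥0∞} (hf : Measurable f) {C : ℝ≥0∞}
    (hC : ComparableOn L 2 f C) (hCn : 2 * C ^ 2 ≤ 2 ^ n) {R : ℝ} (hR : 0 < R)
    (x : EuclideanSpace ℝ (Fin n)) :
    (volume.withDensity fun x : EuclideanSpace ℝ (Fin n) => f ‖x‖) (ball x ((1 + 1 / n) * R)) ≤
      (3 * C + 2 * C ^ 6) *
        (volume.withDensity fun x : EuclideanSpace ℝ (Fin n) => f ‖x‖) (ball x R) := by
  have hn1 : 1 ≤ n := by omega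
  have hgm : Measurable fun x : EuclideanSpace ℝ (Fin n) => f ‖x‖ := hf.comp measurable_norm
  set μ := volume.withDensity fun x : EuclideanSpace ℝ (Fin n) => f ‖x‖ with hμ
  have hn0 : (0:ℝ) < n := by exact_mod_cast hn1
  have hn16 : (1:ℝ) / n ≤ 1 / 16 := by
    apply one_div_le_one_div_of_le (by norm_num); exact_mod_cast hn
  have hninv : (0:ℝ) < 1 / n := by positivity
  set r : ℝ := 1 + 1 / n with hr
  have hr0 : 0 < r := by positivity
  have hrn : r ^ n ≤ 3 := by
    calc r ^ n ≤ (Real.exp (1 / n)) ^ n := by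
          gcongr; rw [hr, add_comm]; exact Real.add_one_le_exp _
      _ = Real.exp 1 := by rw [← Real.exp_nat_mul]; congr 1; field_simp
      _ ≤ 3 := by linarith [Real.exp_one_lt_d9]
  have hrR : r * R ≤ R + R / 16 := by rw [hr]; nlinarith
  -- The two balls can meet only when `‖x‖ < 2 * R`, since `r * R + R / 4 < 2 * R`.
  have hin : μ (ball x (r * R) ∩ ball 0 (R / 4)) ≤ 2 * C ^ 6 * μ (ball x R) := by
    rcases lt_or_ge ‖x‖ (2 * R) with h | h
    · exact (measure_mono Set.inter_subset_right).trans
        (withDensity_norm_ball_zero_le_ball hn1 hL hf hC hCn hR h)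
    · have : ball x (r * R) ∩ ball 0 (R / 4) = ∅ := by
        refine Set.disjoint_iff_inter_eq_empty.mp (ball_disjoint_ball ?_)
        rw [dist_zero_right]; linarith
      rw [this, measure_empty]; exact zero_le
  -- Dilate about `x`: points of `ball x R` move by less than `R / 16`, while their images have norm
  -- at least `R / 4`, so the two norms have ratio below 2.
  have hout : μ (ball x (r * R) \ ball 0 (R / 4)) ≤ 3 * C * μ (ball x R) := by
    have hSm : MeasurableSet (ball x (r * R) \ ball (0 : EuclideanSpace ℝ (Fin n)) (R / 4)) :=
      measurableSet_ball.diff measurableSet_ball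
    set c : EuclideanSpace ℝ (Fin n) := -(1 / (n:ℝ)) • x with hc
    have hT : ∀ y, c + r • y = x + r • (y - x) := fun y => by
      rw [hc, hr]; module
    have hTy : ∀ y, c + r • y - y = (1 / (n:ℝ)) • (y - x) := fun y => by
      rw [hc, hr]; module
    have hsub : (fun y => c + r • y) ⁻¹' (ball x (r * R) \ ball 0 (R / 4)) ⊆
        {y | y ∈ ball x R ∧ R / 4 ≤ ‖c + r • y‖} := by
      rintro y ⟨h1, h2⟩
      refine ⟨?_, by simpa using h2⟩
      change c + r • y ∈ _ at h1
      rw [hT, mem_ball, dist_eq_norm, add_sub_cancel_left, norm_smul, Real.norm_eq_abs,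
        abs_of_pos hr0] at h1
      rw [mem_ball, dist_eq_norm]
      exact lt_of_mul_lt_mul_left h1 hr0.le
    rw [hμ, withDensity_apply _ hSm, withDensity_apply _ measurableSet_ball,
      setLIntegral_comp_add_smul c hr0 hgm hSm, mul_assoc, ← lintegral_const_mul _ hgm]
    have h3 : ENNReal.ofReal (r ^ n) ≤ 3 := by
      rw [← ENNReal.ofReal_ofNat 3]; exact ENNReal.ofReal_le_ofReal hrn
    refine mul_le_mul' h3 ?_
    calc _ ≤ ∫⁻ y in (fun y => c + r • y) ⁻¹' (ball x (r * R) \ ball 0 (R / 4)), C * f ‖y‖ := by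
          refine setLIntegral_mono_ae (hgm.const_mul _).aemeasurable ?_
          filter_upwards [ae_norm_mem hn1 hL,
            (quasiMeasurePreserving_add_smul c hr0).ae (ae_norm_mem hn1 hL)] with y h1 h2 hy
          obtain ⟨hy1, hy2⟩ := hsub hy
          have h3 : ‖c + r • y - y‖ < R / 16 := by
            rw [hTy, norm_smul, Real.norm_eq_abs, abs_of_pos hninv]
            rw [mem_ball, dist_eq_norm] at hy1
            nlinarith [norm_nonneg (y - x)]
          have h4 : ‖c + r • y‖ ≤ ‖c + r • y - y‖ + ‖y‖ := by
            simpa using norm_add_le (c + r • y - y) y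
          have h5 : ‖y‖ ≤ ‖c + r • y - y‖ + ‖c + r • y‖ := by
            rw [← norm_neg (c + r • y - y)]
            simpa using norm_add_le (-(c + r • y - y)) (c + r • y)
          exact hC _ h1 _ h2 (by linarith) (by linarith) (by linarith) (by linarith)
      _ ≤ _ := lintegral_mono_set fun y hy => (hsub hy).1
  calc μ (ball x (r * R)) ≤ μ (ball x (r * R) \ ball 0 (R / 4)) +
        μ (ball x (r * R) ∩ ball 0 (R / 4)) := by
        rw [add_comm]; exact measure_le_inter_add_sdiff _ _ _
    _ ≤ 3 * C * μ (ball x R) + 2 * C ^ 6 * μ (ball x R) := add_le_add hout hin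
    _ = _ := by rw [add_mul]

/-! ### Profiles essentially constant on dyadic annuli. -/

theorem radialMeasure_eq (w₀ : ℝ≥0 → ℝ≥0) (n : ℕ) :
    radialMeasure w₀ n = volume.withDensity
      fun x : EuclideanSpace ℝ (Fin n) => (fun r : ℝ => (w₀ r.toNNReal : ℝ≥0∞)) ‖x‖ := by
  simp only [radialMeasure, norm_toNNReal]

/-- The exceptional null set depends on the annulus, so only rational inner radii `q` are used. Any
two radii of ratio below 2 lie in a common `[q, 2q]`. Passing from points to radii also removes the
dependence on `d`. -/
theorem EssConstOnDyadicAnnuli.comparableOn {d : ℕ} (hd : 1 ≤ d) {w₀ : ℝ≥0 → ℝ≥0}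
    (hw : Measurable w₀) {β : ℝ≥0} (h : EssConstOnDyadicAnnuli d w₀ β) :
    ∃ L : Set ℝ, (∀ᵐ r : ℝ, 0 < r → r ∈ L) ∧
      ComparableOn L 2 (fun r : ℝ => (w₀ r.toNNReal : ℝ≥0∞)) β := by
  set f : ℝ → ℝ≥0∞ := fun r : ℝ => (w₀ r.toNNReal : ℝ≥0∞) with hf
  have hfm : Measurable f := by fun_prop
  set A : ℝ → Set (EuclideanSpace ℝ (Fin d)) := fun R => {x | R ≤ ‖x‖ ∧ ‖x‖ ≤ 2 * R} with hA
  have hAm : ∀ R, MeasurableSet (A R) := fun R =>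
    (measurableSet_le measurable_const measurable_norm).inter
      (measurableSet_le measurable_norm measurable_const)
  set m : ℝ → ℝ≥0∞ := fun R =>
    essInf (fun x : EuclideanSpace ℝ (Fin d) => ((w₀ ‖x‖₊ : ℝ≥0) : ℝ≥0∞)) (volume.restrict (A R))
    with hm
  have key : ∀ R : ℝ, 0 < R →
      ∀ᵐ r : ℝ, 0 < r → r ∈ {r | r ∈ Set.Icc R (2 * R) → m R ≤ f r ∧ f r ≤ β * m R} := by
    intro R hR
    refine (ae_norm_mem_iff hd ?_).mp ?_
    · have : {r | r ∈ Set.Icc R (2 * R) → m R ≤ f r ∧ f r ≤ β * m R} =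
          (Set.Icc R (2 * R))ᶜ ∪ ({r | m R ≤ f r} ∩ {r | f r ≤ β * m R}) := by
        ext r; simp only [Set.mem_ofPred_eq, Set.mem_union, Set.mem_compl_iff, Set.mem_inter_iff]
        tauto
      rw [this]
      exact measurableSet_Icc.compl.union
        ((measurableSet_le measurable_const hfm).inter (measurableSet_le hfm measurable_const))
    · have h1 := ae_essInf_le (μ := volume.restrict (A R))
        (f := fun x : EuclideanSpace ℝ (Fin d) => ((w₀ ‖x‖₊ : ℝ≥0) : ℝ≥0∞))
      have h2 := ENNReal.ae_le_essSup (μ := volume.restrict (A R))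
        (fun x : EuclideanSpace ℝ (Fin d) => ((w₀ ‖x‖₊ : ℝ≥0) : ℝ≥0∞))
      rw [ae_restrict_iff' (hAm R)] at h1 h2
      filter_upwards [h1, h2] with x h1 h2 hx
      simp only [hf, norm_toNNReal]
      exact ⟨h1 hx, (h2 hx).trans (h R hR)⟩
  refine ⟨{r | ∀ q : ℚ, 0 < (q:ℝ) → r ∈ Set.Icc (q:ℝ) (2 * q) →
    m q ≤ f r ∧ f r ≤ β * m q}, ?_, ?_⟩
  · have : ∀ᵐ r : ℝ, ∀ q : ℚ, 0 < (q:ℝ) → 0 < r → r ∈ Set.Icc (q:ℝ) (2 * q) →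
        m q ≤ f r ∧ f r ≤ β * m q := by
      rw [ae_all_iff]
      intro q
      by_cases hq : 0 < (q:ℝ)
      · filter_upwards [key q hq] with r hr _ using hr
      · exact Filter.Eventually.of_forall fun r h => absurd h hq
    filter_upwards [this] with r hr h0 q hq using hr q hq h0
  · intro r hr s hs hr0 hs0 hrs hsr
    have hlt : max r s / 2 < min r s := by
      rcases le_total r s with h' | h'
      · rw [max_eq_right h', min_eq_left h']; linarith
      · rw [max_eq_left h', min_eq_right h']; linarith
    obtain ⟨q, hq1, hq2⟩ := exists_rat_btwn hlt
    have h1 := le_max_left r s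
    have h2 := le_max_right r s
    have h3 := min_le_left r s
    have h4 := min_le_right r s
    have hq0 : 0 < (q:ℝ) := by linarith
    calc f s ≤ β * m q := (hs q hq0 ⟨by linarith, by linarith⟩).2
      _ ≤ β * f r := by gcongr; exact (hr q hq0 ⟨by linarith, by linarith⟩).1

theorem exists_two_mul_sq_le_two_pow (C : ℝ≥0) :
    ∃ N : ℕ, 16 ≤ N ∧ ∀ n : ℕ, N ≤ n → 2 * (C : ℝ≥0∞) ^ 2 ≤ 2 ^ n := by
  obtain ⟨k, hk⟩ := pow_unbounded_of_one_lt (2 * (C : ℝ) ^ 2) (one_lt_two (α := ℝ))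
  refine ⟨16 + k, Nat.le_add_right _ _, fun n hn => ?_⟩
  have h1 : (2:ℝ) ^ k ≤ 2 ^ n := pow_le_pow_right₀ one_le_two (by omega)
  have h2 : (2:ℝ≥0) * C ^ 2 ≤ 2 ^ n := by
    rw [← NNReal.coe_le_coe]
    push_cast
    linarith
  have h3 : ((2 * C ^ 2 : ℝ≥0) : ℝ≥0∞) ≤ ((2 ^ n : ℝ≥0) : ℝ≥0∞) := ENNReal.coe_le_coe.mpr h2
  simpa using h3

/-- A profile with comparable values at comparable radii yields, in large dimension, locally finite
micro-doubling measures. -/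
theorem ComparableOn.isMicroDoubling_radialMeasure {L : Set ℝ} (hL : ∀ᵐ r : ℝ, 0 < r → r ∈ L)
    {w₀ : ℝ≥0 → ℝ≥0} (hw : Measurable w₀) {C : ℝ≥0}
    (hC : ComparableOn L 2 (fun r : ℝ => (w₀ r.toNNReal : ℝ≥0∞)) C) {n : ℕ} (hn : 16 ≤ n)
    (hCn : 2 * (C : ℝ≥0∞) ^ 2 ≤ 2 ^ n) :
    IsLocallyFiniteMeasure (radialMeasure w₀ n) ∧
      IsMicroDoubling (n : ℝ) (radialMeasure w₀ n) (3 * C + 2 * C ^ 6) := by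
  have hfm : Measurable (fun r : ℝ => (w₀ r.toNNReal : ℝ≥0∞)) := by fun_prop
  have hft : ∀ r : ℝ, (fun r : ℝ => (w₀ r.toNNReal : ℝ≥0∞)) r ≠ ∞ := fun _ => ENNReal.coe_ne_top
  have hCt : (C : ℝ≥0∞) ≠ ∞ := ENNReal.coe_ne_top
  have hn1 : 1 ≤ n := by omega
  have h1 := hC.isLocallyFiniteMeasure hn1 hL hfm hft hCt hCn
  have h2 := fun (x : EuclideanSpace ℝ (Fin n)) (R : ℝ) (hR : 0 < R) =>
    hC.withDensity_norm_ball_le hn hL hfm hCn hR x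
  rw [← radialMeasure_eq w₀ n] at h1
  simp only [← radialMeasure_eq w₀ n] at h2
  refine ⟨h1, fun x R hR => ?_⟩
  push_cast
  exact h2 x R hR

/-! ### Low dimensions: covering. -/

/-- In a fixed dimension, weakly doubling measures are micro-doubling. -/
theorem exists_isMicroDoubling_of_isWeaklyDoubling {n : ℕ} (hn : 1 ≤ n) (K₁ : ℝ≥0) :
    ∃ K₀ : ℝ≥0, ∀ μ : Measure (EuclideanSpace ℝ (Fin n)), IsWeaklyDoubling μ K₁ →
      IsMicroDoubling (n : ℝ) μ K₀ := by
  obtain ⟨t, ht2, htf, ht⟩ := finite_cover_balls_of_compact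
    (isCompact_closedBall (0 : EuclideanSpace ℝ (Fin n)) 2) one_pos
  refine ⟨htf.toFinset.card * K₁ ^ 2, fun μ hμ x R hR => ?_⟩
  have hball : ∀ c ∈ t, μ (ball (x + R • c) R) ≤ (K₁ : ℝ≥0∞) ^ 2 * μ (ball x R) := by
    intro c hc
    have hc2 : ‖c‖ ≤ 2 := by simpa using ht2 hc
    -- Weak doubling is applied twice, through the halfway centre: `‖c‖ ≤ 2`, so consecutive centres
    -- are at distance at most `R` and their balls meet.
    set y := x + (R / 2) • c with hy
    have hxy : dist y x ≤ R := by
      rw [hy, dist_eq_norm, add_sub_cancel_left, norm_smul, Real.norm_eq_abs,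
        abs_of_pos (by positivity)]
      nlinarith
    have hyz : dist (x + R • c) y ≤ R := by
      have : x + R • c - y = (R / 2) • c := by rw [hy]; module
      rw [dist_eq_norm, this, norm_smul, Real.norm_eq_abs, abs_of_pos (by positivity)]
      nlinarith
    have hne : ∀ u v : EuclideanSpace ℝ (Fin n), dist v u ≤ R →
        (ball u R ∩ ball v R).Nonempty := by
      intro u v huv
      refine ⟨midpoint ℝ u v, ?_, ?_⟩
      · rw [mem_ball, dist_midpoint_left, Real.norm_eq_abs, dist_comm]
        norm_num
        linarith
      · rw [mem_ball, dist_midpoint_right, Real.norm_eq_abs, dist_comm]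
        norm_num
        linarith
    calc μ (ball (x + R • c) R) ≤ K₁ * μ (ball y R) := hμ _ _ R hR (hne _ _ hyz)
      _ ≤ K₁ * (K₁ * μ (ball x R)) := by gcongr; exact hμ _ _ R hR (hne _ _ hxy)
      _ = _ := by ring
  have hcov : ball x ((1 + 1 / n) * R) ⊆ ⋃ c ∈ htf.toFinset, ball (x + R • c) R := by
    intro y hy
    have hn1 : (1:ℝ) / n ≤ 1 := by
      rw [div_le_one (by exact_mod_cast hn)]; exact_mod_cast hn
    rw [mem_ball, dist_eq_norm] at hy
    have hmem : R⁻¹ • (y - x) ∈ closedBall (0 : EuclideanSpace ℝ (Fin n)) 2 := by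
      rw [mem_closedBall_zero_iff, norm_smul, norm_inv, Real.norm_eq_abs, abs_of_pos hR,
        inv_mul_le_iff₀ hR]
      nlinarith
    obtain ⟨c, hc, hcy⟩ := Set.mem_iUnion₂.mp (ht hmem)
    refine Set.mem_iUnion₂.mpr ⟨c, htf.mem_toFinset.mpr hc, ?_⟩
    rw [mem_ball, dist_eq_norm] at hcy ⊢
    have : y - (x + R • c) = R • (R⁻¹ • (y - x) - c) := by
      rw [smul_sub, smul_inv_smul₀ hR.ne']; abel
    rw [this, norm_smul, Real.norm_eq_abs, abs_of_pos hR]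
    nlinarith
  calc μ (ball x ((1 + 1 / n) * R)) ≤ μ (⋃ c ∈ htf.toFinset, ball (x + R • c) R) :=
        measure_mono hcov
    _ ≤ ∑ c ∈ htf.toFinset, μ (ball (x + R • c) R) := measure_biUnion_finset_le _ _
    _ ≤ ∑ c ∈ htf.toFinset, (K₁ : ℝ≥0∞) ^ 2 * μ (ball x R) :=
        Finset.sum_le_sum fun c hc => hball c (htf.mem_toFinset.mp hc)
    _ = _ := by
        rw [Finset.sum_const, nsmul_eq_mul]
        push_cast
        ring

/-! ### Concentration of the norm in high dimension. -/

/-- If `X n → s` in probability, then the expectations of `F (X n)` converge to `F s`, for `F`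
continuous at `s` and uniformly almost surely bounded along `X n`. -/
theorem tendsto_lintegral_of_tendsto_measure_notMem {Ω : ℕ → Type*} [∀ n, MeasurableSpace (Ω n)]
    (P : ∀ n, Measure (Ω n)) [∀ n, IsProbabilityMeasure (P n)] {X : ∀ n, Ω n → ℝ}
    (hX : ∀ n, Measurable (X n)) {s : ℝ}
    (hs : ∀ U : Set ℝ, IsOpen U → s ∈ U →
      Filter.Tendsto (fun n => P n {ω | X n ω ∉ U}) Filter.atTop (nhds 0))
    {F : ℝ → ℝ≥0∞} (hF : ContinuousAt F s) (hFs : F s ≠ ∞) {M : ℝ≥0∞} (hM : M ≠ ∞)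
    (hFM : ∀ n, ∀ᵐ ω ∂P n, F (X n ω) ≤ M) :
    Filter.Tendsto (fun n => ∫⁻ ω, F (X n ω) ∂P n) Filter.atTop (nhds (F s)) := by
  rw [ENNReal.tendsto_nhds hFs]
  intro ε hε
  have hε2 : 0 < ε / 2 := ENNReal.half_pos hε.ne'
  have hnear : ∀ᶠ r in nhds s, F r ∈ Set.Icc (F s - ε / 2) (F s + ε / 2) :=
    (ENNReal.tendsto_nhds hFs).mp hF _ hε2
  obtain ⟨U, hU, hUo, hsU⟩ := _root_.eventually_nhds_iff.mp hnear
  have hset : ∀ n, MeasurableSet {ω | X n ω ∉ U} := fun n => hX n hUo.measurableSet.compl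
  have hlim : ∀ c : ℝ≥0∞, c ≠ ∞ → ∀ᶠ n in Filter.atTop, c * P n {ω | X n ω ∉ U} ≤ ε / 2 := by
    intro c hc
    have h := ENNReal.Tendsto.const_mul (hs U hUo hsU) (Or.inr hc)
    rw [mul_zero] at h
    exact (h.eventually_lt_const hε2).mono fun _ h => h.le
  have hint : ∀ (n) (a c : ℝ≥0∞), ∫⁻ ω, (a + {ω | X n ω ∉ U}.indicator (fun _ => c) ω) ∂P n =
      a + c * P n {ω | X n ω ∉ U} := by
    intro n a c
    rw [lintegral_add_left measurable_const, lintegral_const, measure_univ, mul_one,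
      lintegral_indicator_const (hset n)]
  filter_upwards [hlim M hM, hlim (F s) hFs] with n h1 h2
  constructor
  · rw [tsub_le_iff_right]
    have hle : ∀ ω, F s ≤ F (X n ω) + (ε / 2 + {ω | X n ω ∉ U}.indicator (fun _ => F s) ω) := by
      intro ω
      by_cases hω : X n ω ∈ U
      · have := (hU _ hω).1
        rw [tsub_le_iff_right] at this
        simpa [hω] using this
      · simp only [Set.indicator, Set.mem_ofPred_eq, hω, not_false_eq_true, if_true]
        exact le_add_left (le_add_left le_rfl)
    calc F s = ∫⁻ _, F s ∂P n := by simp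
      _ ≤ ∫⁻ ω, (F (X n ω) + (ε / 2 + {ω | X n ω ∉ U}.indicator (fun _ => F s) ω)) ∂P n :=
        lintegral_mono hle
      _ = ∫⁻ ω, F (X n ω) ∂P n + (ε / 2 + F s * P n {ω | X n ω ∉ U}) := by
        have hm : Measurable fun ω => ε / 2 + {ω | X n ω ∉ U}.indicator (fun _ => F s) ω :=
          measurable_const.add (measurable_const.indicator (hset n))
        rw [lintegral_add_right _ hm, hint]
      _ ≤ ∫⁻ ω, F (X n ω) ∂P n + (ε / 2 + ε / 2) := by gcongr
      _ = _ := by rw [ENNReal.add_halves]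
  · calc ∫⁻ ω, F (X n ω) ∂P n
        ≤ ∫⁻ ω, (F s + ε / 2 + {ω | X n ω ∉ U}.indicator (fun _ => M) ω) ∂P n := by
          refine lintegral_mono_ae ?_
          filter_upwards [hFM n] with ω hωM
          by_cases hω : X n ω ∈ U
          · exact le_add_right (hU _ hω).2
          · simp only [Set.indicator, Set.mem_ofPred_eq, hω, not_false_eq_true, if_true]
            exact le_add_left hωM
      _ = F s + ε / 2 + M * P n {ω | X n ω ∉ U} := hint _ _ _
      _ ≤ F s + ε / 2 + ε / 2 := by gcongr
      _ = _ := by rw [add_assoc, ENNReal.add_halves]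

/-- The second moment of a coordinate on the unit ball of `ℝⁿ`. -/
theorem lintegral_ball_sq_coord_le {n : ℕ} (i : Fin n) :
    n * ∫⁻ z in ball (0 : EuclideanSpace ℝ (Fin n)) 1, ENNReal.ofReal (z i ^ 2) ≤
      volume (ball (0 : EuclideanSpace ℝ (Fin n)) 1) := by
  have hm : ∀ j : Fin n, Measurable fun z : EuclideanSpace ℝ (Fin n) => ENNReal.ofReal (z j ^ 2) :=
    fun j => by fun_prop
  -- Swapping coordinates is an isometry of the ball, so all coordinates have the same second
  -- moment; their sum is the integral of `‖z‖ ^ 2 ≤ 1`.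
  have hsym : ∀ j : Fin n,
      ∫⁻ z in ball (0 : EuclideanSpace ℝ (Fin n)) 1, ENNReal.ofReal (z j ^ 2) =
        ∫⁻ z in ball (0 : EuclideanSpace ℝ (Fin n)) 1, ENNReal.ofReal (z i ^ 2) := by
    intro j
    set T : EuclideanSpace ℝ (Fin n) ≃ₗᵢ[ℝ] EuclideanSpace ℝ (Fin n) :=
      LinearIsometryEquiv.piLpCongrLeft 2 ℝ ℝ (Equiv.swap i j) with hT
    have h := T.measurePreserving.setLIntegral_comp_preimage
      (s := ball (0 : EuclideanSpace ℝ (Fin n)) 1) measurableSet_ball (hm j)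
    rw [← h]
    have hpre : T ⁻¹' ball (0 : EuclideanSpace ℝ (Fin n)) 1 = ball 0 1 := by
      ext z; simp
    have happ : ∀ z, (T z) j = z i := by
      intro z
      simp [hT, Equiv.piCongrLeft'_apply]
    rw [hpre]
    simp only [happ]
  calc (n : ℝ≥0∞) * ∫⁻ z in ball (0 : EuclideanSpace ℝ (Fin n)) 1, ENNReal.ofReal (z i ^ 2)
      = ∑ j : Fin n, ∫⁻ z in ball (0 : EuclideanSpace ℝ (Fin n)) 1, ENNReal.ofReal (z j ^ 2) := by
        simp [hsym]
    _ = ∫⁻ z in ball (0 : EuclideanSpace ℝ (Fin n)) 1, ENNReal.ofReal (‖z‖ ^ 2) := by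
        rw [← lintegral_finsetSum _ fun j _ => hm j]
        refine lintegral_congr fun z => ?_
        rw [EuclideanSpace.real_norm_sq_eq, ENNReal.ofReal_sum_of_nonneg fun j _ => sq_nonneg _]
    _ ≤ ∫⁻ _ in ball (0 : EuclideanSpace ℝ (Fin n)) 1, 1 := by
        refine setLIntegral_mono measurable_const fun z hz => ?_
        rw [mem_ball_zero_iff] at hz
        rw [ENNReal.ofReal_le_one]
        exact pow_le_one₀ (norm_nonneg z) hz.le
    _ = _ := by simp

/-- Chebyshev's inequality for one coordinate, whose mean square on the ball is at most `1 / n`. -/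
theorem volume_ball_le_abs_coord_le {n : ℕ} (i : Fin n) {δ : ℝ} (hδ : 0 < δ) :
    volume (ball (0 : EuclideanSpace ℝ (Fin n)) 1 ∩ {z | δ ≤ |z i|}) ≤
      ENNReal.ofReal (1 / (n * δ ^ 2)) * volume (ball (0 : EuclideanSpace ℝ (Fin n)) 1) := by
  have hn : (0:ℝ) < n := by exact_mod_cast i.pos
  have h := mul_meas_ge_le_lintegral
    (μ := volume.restrict (ball (0 : EuclideanSpace ℝ (Fin n)) 1))
    (f := fun z : EuclideanSpace ℝ (Fin n) => ENNReal.ofReal (z i ^ 2)) (by fun_prop)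
    (ENNReal.ofReal (δ ^ 2))
  have hset : {z : EuclideanSpace ℝ (Fin n) | ENNReal.ofReal (δ ^ 2) ≤ ENNReal.ofReal (z i ^ 2)} =
      {z | δ ≤ |z i|} := by
    ext z
    rw [Set.mem_ofPred_eq, Set.mem_ofPred_eq, ENNReal.ofReal_le_ofReal_iff (sq_nonneg _),
      sq_le_sq, abs_of_pos hδ]
  have hms : MeasurableSet {z : EuclideanSpace ℝ (Fin n) | δ ≤ |z i|} :=
    measurableSet_le measurable_const (by fun_prop)
  rw [hset, Measure.restrict_apply hms, Set.inter_comm] at h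
  have h2 := (mul_le_mul_right h (n : ℝ≥0∞)).trans (lintegral_ball_sq_coord_le i)
  rw [← mul_assoc, ← ENNReal.ofReal_natCast, ← ENNReal.ofReal_mul hn.le] at h2
  rw [one_div, ENNReal.ofReal_inv_of_pos (by positivity), ← ENNReal.div_eq_inv_mul,
    ENNReal.le_div_iff_mul_le (Or.inl (ENNReal.ofReal_pos.mpr (by positivity)).ne')
      (Or.inl ENNReal.ofReal_ne_top), mul_comm]
  exact h2

/-- After translation the squared norm is `t² + 2 t z₀ + ‖z‖²`. It is near `1 + t²` unless `|z₀| ≥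
δ` or `‖z‖ < 1 - δ`, and both events have small relative volume. -/
theorem volume_ball_single_sq_norm_far_le {n : ℕ} {t : ℝ} (ht : 0 ≤ t) {δ : ℝ} (hδ : 0 < δ)
    (hδ1 : δ < 1) :
    volume (ball (EuclideanSpace.single (0 : Fin (n + 1)) t) 1 ∩
        {u | 2 * δ * (t + 1) ≤ |‖u‖ ^ 2 - (1 + t ^ 2)|}) ≤
      (ENNReal.ofReal (1 / ((n + 1 : ℕ) * δ ^ 2)) + ENNReal.ofReal ((1 - δ) ^ (n + 1))) *
        volume (ball (0 : EuclideanSpace ℝ (Fin (n + 1))) 1) := by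
  set c := EuclideanSpace.single (0 : Fin (n + 1)) t with hc
  have hsub : (fun z => c + z) ⁻¹' (ball c 1 ∩ {u | 2 * δ * (t + 1) ≤ |‖u‖ ^ 2 - (1 + t ^ 2)|}) ⊆
      (ball (0 : EuclideanSpace ℝ (Fin (n + 1))) 1 ∩ {z | δ ≤ |z 0|}) ∪ ball 0 (1 - δ) := by
    rintro z ⟨h1, h2⟩
    by_contra hcon
    simp only [Set.mem_union, Set.mem_inter_iff, mem_ball_zero_iff, Set.mem_ofPred_eq, not_or,
      not_and, not_le, not_lt] at hcon
    have hz1 : ‖z‖ < 1 := by simpa using h1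
    obtain ⟨h3, h4⟩ := hcon
    have h5 := h3 hz1
    simp only [Set.mem_ofPred_eq] at h2
    have hnorm : ‖c + z‖ ^ 2 = t ^ 2 + 2 * (t * z 0) + ‖z‖ ^ 2 := by
      rw [norm_add_sq_real, hc, EuclideanSpace.inner_single_left, PiLp.norm_single]
      simp
    rw [hnorm] at h2
    have h6 : |t ^ 2 + 2 * (t * z 0) + ‖z‖ ^ 2 - (1 + t ^ 2)| < 2 * δ * (t + 1) := by
      rw [abs_lt] at h5 ⊢
      constructor <;> nlinarith [norm_nonneg z]
    linarith
  rw [← measure_preimage_add volume c]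
  refine (measure_mono hsub).trans ((measure_union_le _ _).trans ?_)
  rw [add_mul]
  refine add_le_add (volume_ball_le_abs_coord_le 0 hδ) (le_of_eq ?_)
  rw [Measure.addHaar_ball _ _ (by linarith), finrank_euclideanSpace_fin]

/-- In high dimension, the norm is concentrated near `√(1 + t²)` on a unit ball whose centre has
norm `t`. -/
theorem tendsto_average_norm_ball_single {t : ℝ} (ht : 0 ≤ t) {F : ℝ → ℝ≥0∞}
    (hF : ContinuousAt F √(1 + t ^ 2)) (hFs : F √(1 + t ^ 2) ≠ ∞) {M : ℝ≥0∞} (hM : M ≠ ∞)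
    (hFM : ∀ r ∈ Set.Ioo (t - 1) (t + 1), F r ≤ M) :
    Filter.Tendsto (fun n : ℕ => (volume (ball (0 : EuclideanSpace ℝ (Fin (n + 1))) 1))⁻¹ *
        ∫⁻ u in ball (EuclideanSpace.single (0 : Fin (n + 1)) t) 1, F ‖u‖)
      Filter.atTop (nhds (F √(1 + t ^ 2))) := by
  set V : ℕ → ℝ≥0∞ := fun n => volume (ball (0 : EuclideanSpace ℝ (Fin (n + 1))) 1) with hV
  have hV0 : ∀ n, V n ≠ 0 := fun n => (measure_ball_pos _ _ one_pos).ne'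
  have hVt : ∀ n, V n ≠ ∞ := fun n => measure_ball_lt_top.ne
  set P : ∀ n : ℕ, Measure (EuclideanSpace ℝ (Fin (n + 1))) := fun n =>
    (V n)⁻¹ • volume.restrict (ball (EuclideanSpace.single (0 : Fin (n + 1)) t) 1) with hP
  have hprob : ∀ n, IsProbabilityMeasure (P n) := fun n => ⟨by
    rw [hP, Measure.smul_apply, Measure.restrict_apply_univ, Measure.addHaar_ball_center,
      smul_eq_mul, ENNReal.inv_mul_cancel (hV0 n) (hVt n)]⟩
  have hPint : ∀ n, ∫⁻ u, F ‖u‖ ∂P n = (V n)⁻¹ *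
      ∫⁻ u in ball (EuclideanSpace.single (0 : Fin (n + 1)) t) 1, F ‖u‖ := fun n => by
    rw [hP, lintegral_smul_measure, smul_eq_mul]
  refine Filter.Tendsto.congr hPint ?_
  refine tendsto_lintegral_of_tendsto_measure_notMem P (X := fun n u => ‖u‖)
    (fun n => measurable_norm) ?_ hF hFs hM ?_
  · intro U hU hsU
    -- Continuity of the square root converts closeness of squared norms, which the volume bound
    -- controls, into closeness of norms.
    obtain ⟨η, hη, hball⟩ : ∃ η > 0, ∀ r : ℝ, 0 ≤ r → |r ^ 2 - (1 + t ^ 2)| < η → r ∈ U := by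
      have hcont : ContinuousAt Real.sqrt (1 + t ^ 2) := Real.continuous_sqrt.continuousAt
      obtain ⟨η, hη, h⟩ := Metric.eventually_nhds_iff.mp (hcont (hU.mem_nhds hsU))
      refine ⟨η, hη, fun r hr hr2 => ?_⟩
      have := h (y := r ^ 2) (by rwa [Real.dist_eq])
      rwa [Real.sqrt_sq hr] at this
    set δ := min (1 / 2) (η / (2 * (t + 1))) with hδ
    have hδ0 : 0 < δ := by positivity
    have hδ1 : δ < 1 := (min_le_left _ _).trans_lt (by norm_num)
    have hδη : 2 * δ * (t + 1) ≤ η := by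
      have := min_le_right (1 / 2) (η / (2 * (t + 1)))
      rw [← hδ, le_div_iff₀ (by positivity)] at this
      linarith
    have hle : ∀ n, P n {u | ‖u‖ ∉ U} ≤
        ENNReal.ofReal (1 / ((n + 1 : ℕ) * δ ^ 2)) + ENNReal.ofReal ((1 - δ) ^ (n + 1)) := by
      intro n
      have hms : MeasurableSet {u : EuclideanSpace ℝ (Fin (n + 1)) | ‖u‖ ∉ U} :=
        measurable_norm hU.measurableSet.compl
      rw [hP, Measure.smul_apply, Measure.restrict_apply hms, smul_eq_mul,
        ← ENNReal.div_eq_inv_mul]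
      refine ENNReal.div_le_of_le_mul ?_
      refine le_trans (measure_mono ?_) (volume_ball_single_sq_norm_far_le ht hδ0 hδ1)
      rintro u ⟨h1, h2⟩
      refine ⟨h2, ?_⟩
      by_contra hcon
      rw [Set.mem_ofPred_eq, not_le] at hcon
      exact h1 (hball _ (norm_nonneg u) (hcon.trans_le hδη))
    have hlim1 : Filter.Tendsto (fun n : ℕ => 1 / (((n + 1 : ℕ) : ℝ) * δ ^ 2)) Filter.atTop
        (nhds 0) := by
      have h := (tendsto_one_div_add_atTop_nhds_zero_nat (𝕜 := ℝ)).mul_const ((δ ^ 2)⁻¹)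
      rw [zero_mul] at h
      refine h.congr fun n => ?_
      push_cast
      field_simp
    have hlim2 : Filter.Tendsto (fun n : ℕ => (1 - δ) ^ (n + 1)) Filter.atTop (nhds 0) :=
      (tendsto_pow_atTop_nhds_zero_of_lt_one (by linarith) (by linarith)).comp
        (Filter.tendsto_add_atTop_nat 1)
    have hlim := (ENNReal.tendsto_ofReal hlim1).add (ENNReal.tendsto_ofReal hlim2)
    rw [ENNReal.ofReal_zero, add_zero] at hlim
    exact tendsto_of_tendsto_of_tendsto_of_le_of_le tendsto_const_nhds hlim
      (fun n => zero_le) hle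
  · intro n
    refine Measure.ae_smul_measure ?_ _
    filter_upwards [ae_restrict_mem measurableSet_ball] with u hu
    have hcn : ‖EuclideanSpace.single (0 : Fin (n + 1)) t‖ = t := by
      rw [PiLp.norm_single, Real.norm_eq_abs, abs_of_nonneg ht]
    rw [mem_ball, dist_eq_norm] at hu
    have h1 := abs_lt.mp ((abs_norm_sub_norm_le u (EuclideanSpace.single 0 t)).trans_lt hu)
    rw [hcn] at h1
    exact hFM _ ⟨by linarith [h1.1], by linarith [h1.2]⟩

/-! ### From weak doubling to comparability. -/

/-- Weak doubling, read off at two balls of radius `R` and rescaled to unit balls. -/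
theorem IsWeaklyDoubling.lintegral_unit_ball_le {n : ℕ} {f : ℝ → ℝ≥0∞} (hf : Measurable f)
    {K : ℝ≥0} (hK : IsWeaklyDoubling
      (volume.withDensity fun x : EuclideanSpace ℝ (Fin n) => f ‖x‖) K)
    {c c' : EuclideanSpace ℝ (Fin n)} (hcc : dist c c' < 2) {R : ℝ} (hR : 0 < R) :
    ∫⁻ u in ball c 1, f (R * ‖u‖) ≤ K * ∫⁻ u in ball c' 1, f (R * ‖u‖) := by
  have hgm : Measurable fun x : EuclideanSpace ℝ (Fin n) => f ‖x‖ := hf.comp measurable_norm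
  have hscale : ∀ c : EuclideanSpace ℝ (Fin n),
      (volume.withDensity fun x : EuclideanSpace ℝ (Fin n) => f ‖x‖) (ball (R • c) R) =
        ENNReal.ofReal (R ^ n) * ∫⁻ u in ball c 1, f (R * ‖u‖) := by
    intro c
    rw [withDensity_apply _ measurableSet_ball,
      setLIntegral_comp_add_smul 0 hR hgm measurableSet_ball]
    have hpre : (fun y : EuclideanSpace ℝ (Fin n) => 0 + R • y) ⁻¹' ball (R • c) R = ball c 1 := by
      ext y
      rw [Set.mem_preimage, zero_add, mem_ball, mem_ball, dist_smul₀, Real.norm_eq_abs,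
        abs_of_pos hR, mul_lt_iff_lt_one_right hR]
    rw [hpre]
    simp only [zero_add, norm_smul, Real.norm_eq_abs, abs_of_pos hR]
  have hne : (ball (R • c') R ∩ ball (R • c) R).Nonempty := by
    have hd : dist (R • c) (R • c') < 2 * R := by
      rw [dist_smul₀, Real.norm_eq_abs, abs_of_pos hR]; nlinarith
    refine ⟨midpoint ℝ (R • c) (R • c'), ?_, ?_⟩
    · rw [mem_ball, dist_midpoint_right, Real.norm_eq_abs]
      norm_num
      linarith
    · rw [mem_ball, dist_midpoint_left, Real.norm_eq_abs]
      norm_num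
      linarith
  have h := hK (R • c') (R • c) R hR hne
  rw [hscale, hscale, mul_left_comm] at h
  have hp : 0 < R ^ n := by positivity
  exact (ENNReal.mul_le_mul_iff_right (ENNReal.ofReal_pos.mpr hp).ne' ENNReal.ofReal_ne_top).mp h

/-- Integration over radii in `IsWeaklyDoubling.lintegral_unit_ball_le`. -/
theorem IsWeaklyDoubling.lintegral_unit_ball_lintegral_le {n : ℕ} {f : ℝ → ℝ≥0∞}
    (hf : Measurable f) {K : ℝ≥0} (hK : IsWeaklyDoubling
      (volume.withDensity fun x : EuclideanSpace ℝ (Fin n) => f ‖x‖) K)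
    {c c' : EuclideanSpace ℝ (Fin n)} (hcc : dist c c' < 2) {a b : ℝ} (ha : 0 < a) :
    ∫⁻ u in ball c 1, ∫⁻ R in Set.Ioc a b, f (R * ‖u‖) ≤
      K * ∫⁻ u in ball c' 1, ∫⁻ R in Set.Ioc a b, f (R * ‖u‖) := by
  have hm : Measurable fun p : EuclideanSpace ℝ (Fin n) × ℝ => f (p.2 * ‖p.1‖) :=
    hf.comp (by fun_prop)
  have hm' : Measurable fun R : ℝ => ∫⁻ u in ball c' 1, f (R * ‖u‖) :=
    (hm.comp measurable_swap).lintegral_prod_right'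
  have hswap : ∀ c : EuclideanSpace ℝ (Fin n),
      ∫⁻ u in ball c 1, ∫⁻ R in Set.Ioc a b, f (R * ‖u‖) =
        ∫⁻ R in Set.Ioc a b, ∫⁻ u in ball c 1, f (R * ‖u‖) :=
    fun c => lintegral_lintegral_swap hm.aemeasurable
  rw [hswap, hswap, ← lintegral_const_mul _ hm']
  exact setLIntegral_mono (hm'.const_mul _) fun R hR =>
    hK.lintegral_unit_ball_le hf hcc (ha.trans hR.1)

/-- Primitives of a function integrable on compact subintervals of `(0, ∞)` are continuous. -/
theorem continuousAt_primitive_of_pos {g : ℝ → ℝ}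
    (hg : ∀ a b, 0 < a → 0 < b → IntervalIntegrable g volume a b) {x : ℝ} (hx : 0 < x) :
    ContinuousAt (fun x => ∫ y in (1:ℝ)..x, g y) x := by
  have h := intervalIntegral.continuousOn_primitive_interval' (a := 1)
    (hg (min x 1 / 2) (2 * max x 1) (by positivity) (by positivity)) ?_
  · refine h.continuousAt ?_
    have h1 := min_le_left x 1
    have h2 := le_max_left x 1
    have h3 : 0 < min x 1 := by positivity
    rw [Set.uIcc_of_le (by linarith)]
    exact Icc_mem_nhds (by linarith) (by linarith)
  · have h1 := min_le_right x 1
    have h2 := le_max_right x 1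
    have h3 : 0 < min x 1 := by positivity
    rw [Set.uIcc_of_le (by linarith)]
    exact ⟨by linarith, by linarith⟩

/-- Lebesgue differentiation on each interval `[1/(k+1), k+1]`; these exhaust the half-line and all
contain the base point 1. -/
theorem ae_hasDerivAt_primitive_of_pos {g : ℝ → ℝ}
    (hg : ∀ a b, 0 < a → 0 < b → IntervalIntegrable g volume a b) :
    ∀ᵐ x : ℝ, 0 < x → HasDerivAt (fun x => ∫ y in (1:ℝ)..x, g y) (g x) x := by
  have h : ∀ᵐ x : ℝ, ∀ k : ℕ, x ∈ Set.uIcc (1 / ((k : ℝ) + 1)) (k + 1) →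
      ∀ c ∈ Set.uIcc (1 / ((k : ℝ) + 1)) (k + 1),
        HasDerivAt (fun x => ∫ y in c..x, g y) (g x) x :=
    ae_all_iff.mpr fun k => (hg _ _ (by positivity) (by positivity)).ae_hasDerivAt_integral
  filter_upwards [h] with x hx hx0
  obtain ⟨k, hk⟩ := exists_nat_ge (max x (1 / x))
  have h1 := (le_max_left _ _).trans hk
  have h2 := (le_max_right _ _).trans hk
  have hk1 : 1 / ((k : ℝ) + 1) ≤ 1 := by
    rw [div_le_one (by positivity)]; linarith [(Nat.cast_nonneg k : (0:ℝ) ≤ k)]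
  have hk2 : (1:ℝ) ≤ k + 1 := by linarith [(Nat.cast_nonneg k : (0:ℝ) ≤ k)]
  refine hx k ?_ 1 ?_
  · rw [Set.uIcc_of_le (hk1.trans hk2)]
    refine ⟨?_, by linarith⟩
    rw [div_le_iff₀ (by positivity)]
    rw [div_le_iff₀ hx0] at h2
    nlinarith
  · rw [Set.uIcc_of_le (hk1.trans hk2)]
    exact ⟨hk1, hk2⟩

/-- Local finiteness of the radial measure in some dimension `n ≥ 1` gives local integrability of its
profile on `(0, ∞)`. -/
theorem intervalIntegrable_of_isLocallyFiniteMeasure {n : ℕ} (hn : 1 ≤ n) {g : ℝ → ℝ}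
    (hg : Measurable g) (hg0 : ∀ r, 0 ≤ g r)
    (h : IsLocallyFiniteMeasure
      (volume.withDensity fun x : EuclideanSpace ℝ (Fin n) => ENNReal.ofReal (g ‖x‖)))
    {a b : ℝ} (ha : 0 < a) (hb : 0 < b) : IntervalIntegrable g volume a b := by
  have : Nonempty (Fin n) := ⟨⟨0, hn⟩⟩
  have hball := measure_ball_lt_top (x := (0 : EuclideanSpace ℝ (Fin n))) (r := max a b + 1)
    (μ := volume.withDensity fun x : EuclideanSpace ℝ (Fin n) => ENNReal.ofReal (g ‖x‖))
  rw [withDensity_apply _ measurableSet_ball] at hball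
  have hI : IntegrableOn (fun x : EuclideanSpace ℝ (Fin n) => g ‖x‖) (ball 0 (max a b + 1)) := by
    refine ⟨(hg.comp measurable_norm).aestronglyMeasurable, ?_⟩
    rw [hasFiniteIntegral_iff_ofReal (Filter.Eventually.of_forall fun x => hg0 _)]
    exact hball
  rw [integrableOn_fun_norm_addHaar, finrank_euclideanSpace_fin] at hI
  have hsub : Set.uIcc a b ⊆ Set.Ioo 0 (max a b + 1) := fun y hy =>
    ⟨(lt_min ha hb).trans_le hy.1, hy.2.trans_lt (lt_add_one _)⟩
  rw [intervalIntegrable_iff']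
  -- Polar coordinates give integrability of `y ^ (n - 1) * g y`; the weight is bounded away from 0
  -- on the interval and can be divided out.
  have hc : ContinuousOn (fun y : ℝ => (y ^ (n - 1))⁻¹) (Set.uIcc a b) :=
    (continuous_pow _).continuousOn.inv₀ fun y hy => (pow_pos (hsub hy).1 _).ne'
  refine ((hI.mono_set hsub).continuousOn_mul hc isCompact_uIcc).congr_fun (fun y hy => ?_)
    measurableSet_uIcc
  have : y ^ (n - 1) ≠ 0 := (pow_pos (hsub hy).1 _).ne'
  simp only [smul_eq_mul]
  field_simp

theorem lintegral_Ioc_comp_mul_eq {g : ℝ → ℝ} (hg0 : ∀ r, 0 ≤ g r)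
    (hg : ∀ a b, 0 < a → 0 < b → IntervalIntegrable g volume a b) {a b ρ : ℝ} (ha : 0 < a)
    (hab : a ≤ b) (hρ : 0 < ρ) :
    ∫⁻ R in Set.Ioc a b, ENNReal.ofReal (g (R * ρ)) =
      ENNReal.ofReal (ρ⁻¹ * ((∫ y in (1:ℝ)..(b * ρ), g y) - ∫ y in (1:ℝ)..(a * ρ), g y)) := by
  have hb : 0 < b := ha.trans_le hab
  have hi : IntervalIntegrable (fun R => g (R * ρ)) volume a b := by
    have := (hg (a * ρ) (b * ρ) (by positivity) (by positivity)).comp_mul_right (c := ρ)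
    rwa [mul_div_cancel_right₀ _ hρ.ne', mul_div_cancel_right₀ _ hρ.ne'] at this
  rw [intervalIntegral.integral_interval_sub_left (hg _ _ one_pos (by positivity))
    (hg _ _ one_pos (by positivity)), ← smul_eq_mul,
    ← intervalIntegral.integral_comp_mul_right _ hρ.ne', intervalIntegral.integral_of_le hab,
    ofReal_integral_eq_lintegral_ofReal hi.1 (Filter.Eventually.of_forall fun _ => hg0 _)]

/-- Averaging over `R` makes the integrand a continuous function of the norm, so concentration
applies on both sides as the dimension grows. The condition `t > 1` keeps the unit balls away from
the origin, near which `g` need not be bounded or integrable. -/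
theorem ofReal_average_le_of_isWeaklyDoubling {g : ℝ → ℝ} (hgm : Measurable g)
    (hg0 : ∀ r, 0 ≤ g r) (hg : ∀ a b, 0 < a → 0 < b → IntervalIntegrable g volume a b) {N : ℕ}
    {K : ℝ≥0} (hK : ∀ n, N ≤ n → IsWeaklyDoubling
      (volume.withDensity fun x : EuclideanSpace ℝ (Fin n) => ENNReal.ofReal (g ‖x‖)) K)
    {t t' : ℝ} (ht : 1 < t) (ht' : 1 < t') (htt : |t - t'| < 2) {a b : ℝ} (ha : 0 < a)
    (hab : a ≤ b) :
    ∫⁻ R in Set.Ioc a b, ENNReal.ofReal (g (R * √(1 + t ^ 2))) ≤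
      K * ∫⁻ R in Set.Ioc a b, ENNReal.ofReal (g (R * √(1 + t' ^ 2))) := by
  have hb : 0 < b := ha.trans_le hab
  set F : ℝ → ℝ≥0∞ := fun ρ => ∫⁻ R in Set.Ioc a b, ENNReal.ofReal (g (R * ρ)) with hF
  set Φ : ℝ → ℝ := fun ρ =>
    ρ⁻¹ * ((∫ y in (1:ℝ)..(b * ρ), g y) - ∫ y in (1:ℝ)..(a * ρ), g y) with hΦ
  have hFΦ : ∀ ρ, 0 < ρ → F ρ = ENNReal.ofReal (Φ ρ) := fun ρ hρ =>
    lintegral_Ioc_comp_mul_eq hg0 hg ha hab hρ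
  have hΦc : ∀ ρ, 0 < ρ → ContinuousAt Φ ρ := by
    intro ρ hρ
    refine (continuousAt_inv₀ hρ.ne').mul (ContinuousAt.sub ?_ ?_)
    · exact ContinuousAt.comp (f := fun ρ => b * ρ)
        (continuousAt_primitive_of_pos hg (by positivity)) (by fun_prop)
    · exact ContinuousAt.comp (f := fun ρ => a * ρ)
        (continuousAt_primitive_of_pos hg (by positivity)) (by fun_prop)
  have hFc : ∀ ρ, 0 < ρ → ContinuousAt F ρ := fun ρ hρ =>
    (ENNReal.continuous_ofReal.continuousAt.comp (hΦc ρ hρ)).congr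
      ((eventually_gt_nhds hρ).mono fun ρ' hρ' => (hFΦ ρ' hρ').symm)
  have hlim : ∀ t : ℝ, 1 < t → Filter.Tendsto
      (fun n : ℕ => (volume (ball (0 : EuclideanSpace ℝ (Fin (n + 1))) 1))⁻¹ *
        ∫⁻ u in ball (EuclideanSpace.single (0 : Fin (n + 1)) t) 1, F ‖u‖)
      Filter.atTop (nhds (F √(1 + t ^ 2))) := by
    intro t ht
    have hs : 0 < √(1 + t ^ 2) := by positivity
    obtain ⟨M, hM⟩ := (isCompact_Icc (a := t - 1) (b := t + 1)).bddAbove_image (f := Φ)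
      fun ρ hρ => (hΦc ρ (by linarith [hρ.1])).continuousWithinAt
    refine tendsto_average_norm_ball_single (by linarith) (hFc _ hs) ?_
      (M := ENNReal.ofReal M) ENNReal.ofReal_ne_top fun ρ hρ => ?_
    · rw [hFΦ _ hs]; exact ENNReal.ofReal_ne_top
    · rw [hFΦ ρ (by linarith [hρ.1])]
      exact ENNReal.ofReal_le_ofReal (hM ⟨ρ, ⟨hρ.1.le, hρ.2.le⟩, rfl⟩)
  refine le_of_tendsto_of_tendsto (hlim t ht)
    (ENNReal.Tendsto.const_mul (hlim t' ht') (Or.inr ENNReal.coe_ne_top)) ?_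
  filter_upwards [Filter.eventually_ge_atTop N] with n hn
  rw [mul_left_comm]
  gcongr
  have hdist : dist (EuclideanSpace.single (0 : Fin (n + 1)) t)
      (EuclideanSpace.single (0 : Fin (n + 1)) t') < 2 := by
    rw [PiLp.dist_single_same, Real.dist_eq]; exact htt
  exact (hK (n + 1) (by omega)).lintegral_unit_ball_lintegral_le
    (f := fun r => ENNReal.ofReal (g r)) (by fun_prop) hdist ha

theorem comparableOn_of_isWeaklyDoubling {g : ℝ → ℝ} (hgm : Measurable g)
    (hg0 : ∀ r, 0 ≤ g r) (hg : ∀ a b, 0 < a → 0 < b → IntervalIntegrable g volume a b) {N : ℕ}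
    {K : ℝ≥0} (hK : ∀ n, N ≤ n → IsWeaklyDoubling
      (volume.withDensity fun x : EuclideanSpace ℝ (Fin n) => ENNReal.ofReal (g ‖x‖)) K) :
    ComparableOn {x | HasDerivAt (fun x => ∫ y in (1:ℝ)..x, g y) (g x) x} 2
      (fun r => ENNReal.ofReal (g r)) K := by
  intro r hr s hs hr0 hs0 hrs hsr
  set G : ℝ → ℝ := fun x => ∫ y in (1:ℝ)..x, g y with hG
  have hm : 0 < min r s := lt_min hr0 hs0
  -- This scaling sends the smaller radius to `3/2` and the larger below 3. Solving `√(1 + t²) = k *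
  -- x` on that range gives `1 < t < 3`, so the two centres are less than 2 apart.
  set k : ℝ := 3 / 2 / min r s with hk
  have hk0 : 0 < k := by positivity
  have hrad : ∀ x, min r s ≤ x → x < 2 * min r s →
      ∃ t : ℝ, 1 < t ∧ t < 3 ∧ √(1 + t ^ 2) = k * x := by
    intro x hx1 hx2
    have h1 : 3 / 2 ≤ k * x := by
      rw [hk, div_mul_eq_mul_div, le_div_iff₀ hm]; nlinarith
    have h2 : k * x < 3 := by
      rw [hk, div_mul_eq_mul_div, div_lt_iff₀ hm]; nlinarith
    refine ⟨√((k * x) ^ 2 - 1), ?_, ?_, ?_⟩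
    · rw [Real.lt_sqrt (by norm_num)]; nlinarith
    · rw [Real.sqrt_lt' (by norm_num)]; nlinarith
    · rw [Real.sq_sqrt (by nlinarith), add_sub_cancel, Real.sqrt_sq (by linarith)]
  obtain ⟨t, ht1, ht3, ht⟩ := hrad s (min_le_right _ _) (by
    rcases min_choice r s with h | h <;> rw [h] <;> linarith)
  obtain ⟨t', ht1', ht3', ht'⟩ := hrad r (min_le_left _ _) (by
    rcases min_choice r s with h | h <;> rw [h] <;> linarith)
  -- For `R` in `(1/k, (1+h)/k]` the radius `R * (k * x)` runs over `(x, (1+h) * x]`, so each side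
  -- is a multiple of a difference quotient of the primitive, with the same factor `h / k`.
  have hav : ∀ h : ℝ, 0 < h → ENNReal.ofReal ((s * h)⁻¹ • (G (s + s * h) - G s)) ≤
      K * ENNReal.ofReal ((r * h)⁻¹ • (G (r + r * h) - G r)) := by
    intro h hh
    have hle := ofReal_average_le_of_isWeaklyDoubling hgm hg0 hg hK ht1 ht1'
      (abs_lt.mpr ⟨by linarith, by linarith⟩) (a := 1 / k) (b := (1 + h) / k) (by positivity)
      (by gcongr; linarith)
    have hend : ∀ x : ℝ, 0 < x → ∫⁻ R in Set.Ioc (1 / k) ((1 + h) / k),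
        ENNReal.ofReal (g (R * (k * x))) =
          ENNReal.ofReal (h / k) * ENNReal.ofReal ((x * h)⁻¹ • (G (x + x * h) - G x)) := by
      intro x hx
      rw [lintegral_Ioc_comp_mul_eq hg0 hg (by positivity) (by gcongr; linarith) (by positivity),
        ← ENNReal.ofReal_mul (by positivity), smul_eq_mul,
        show (1 + h) / k * (k * x) = x + x * h by field_simp,
        show 1 / k * (k * x) = x by field_simp]
      congr 1
      field_simp
      simp only [hG]
    rw [ht, ht', hend s hs0, hend r hr0, mul_left_comm] at hle
    have hhk : 0 < h / k := by positivity
    exact (ENNReal.mul_le_mul_iff_right (ENNReal.ofReal_pos.mpr hhk).ne'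
      ENNReal.ofReal_ne_top).mp hle
  have hlim : ∀ x, 0 < x → HasDerivAt G (g x) x → Filter.Tendsto
      (fun h : ℝ => ENNReal.ofReal ((x * h)⁻¹ • (G (x + x * h) - G x)))
      (nhdsWithin 0 (Set.Ioi 0)) (nhds (ENNReal.ofReal (g x))) := by
    intro x hx hd
    have hmul : Filter.Tendsto (fun h : ℝ => x * h) (nhdsWithin 0 (Set.Ioi 0))
        (nhdsWithin 0 (Set.Ioi 0)) := by
      refine tendsto_nhdsWithin_iff.mpr ⟨?_, ?_⟩
      · have : Filter.Tendsto (fun h : ℝ => x * h) (nhds 0) (nhds (x * 0)) :=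
          (continuous_const_mul x).tendsto 0
        rw [mul_zero] at this
        exact this.mono_left nhdsWithin_le_nhds
      · filter_upwards [self_mem_nhdsWithin] with h hh using mul_pos hx hh
    exact ENNReal.tendsto_ofReal (hd.tendsto_slope_zero_right.comp hmul)
  refine le_of_tendsto_of_tendsto (hlim s hs0 hs)
    (ENNReal.Tendsto.const_mul (hlim r hr0 hr) (Or.inr ENNReal.coe_ne_top)) ?_
  filter_upwards [self_mem_nhdsWithin] with h hh using hav h hh

/-! ### Combining low and high dimensions. -/

theorem UniformlyWeaklyDoubling.uniformlyStrongMicroDoubling {w₀ : ℝ≥0 → ℝ≥0}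
    (hw : Measurable w₀) {N : ℕ} (hN : 1 ≤ N)
    (hlf : IsLocallyFiniteMeasure (radialMeasure w₀ N)) (h : UniformlyWeaklyDoubling w₀ N) :
    UniformlyStrongMicroDoubling w₀ N := by
  obtain ⟨K₁, hK₁, hK⟩ := h
  set g : ℝ → ℝ := fun r => (w₀ r.toNNReal : ℝ) with hg
  have hgm : Measurable g := by fun_prop
  have hg0 : ∀ r, 0 ≤ g r := fun r => NNReal.coe_nonneg _
  have hgf : (fun r : ℝ => (w₀ r.toNNReal : ℝ≥0∞)) = fun r => ENNReal.ofReal (g r) := by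
    funext r
    rw [hg, ENNReal.ofReal_coe_nnreal]
  have hrad : ∀ n, radialMeasure w₀ n =
      volume.withDensity fun x : EuclideanSpace ℝ (Fin n) => ENNReal.ofReal (g ‖x‖) := by
    intro n
    rw [radialMeasure_eq, hgf]
  rw [hrad] at hlf
  have hgi : ∀ a b, 0 < a → 0 < b → IntervalIntegrable g volume a b := fun a b ha hb =>
    intervalIntegrable_of_isLocallyFiniteMeasure hN hgm hg0 hlf ha hb
  have hcomp := comparableOn_of_isWeaklyDoubling hgm hg0 hgi (N := N) (K := K₁)
    fun n hn => hrad n ▸ hK n hn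
  rw [← hgf] at hcomp
  obtain ⟨N', hN', hpow⟩ := exists_two_mul_sq_le_two_pow K₁
  have hsmall : ∀ n : ℕ, ∃ K₀ : ℝ≥0, N ≤ n → IsMicroDoubling (n : ℝ) (radialMeasure w₀ n) K₀ := by
    intro n
    by_cases hn : N ≤ n
    · obtain ⟨K₀, hK₀⟩ := exists_isMicroDoubling_of_isWeaklyDoubling (hN.trans hn) K₁
      exact ⟨K₀, fun _ => hK₀ _ (hK n hn)⟩
    · exact ⟨0, fun h => absurd h hn⟩
  choose k hk using hsmall
  -- One constant for all dimensions: the sum dominates the covering constants of the finitely many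
  -- dimensions below `N'`, and the remaining term is the dimension-free constant from
  -- comparability.
  refine ⟨∑ n ∈ Finset.range N', k n + (3 * K₁ + 2 * K₁ ^ 6), K₁, by positivity, hK₁,
    fun n hn => ⟨fun x R hR => ?_, hK n hn⟩⟩
  rcases lt_or_ge n N' with hlt | hge
  · refine (hk n hn x R hR).trans ?_
    have hle : k n ≤ ∑ n ∈ Finset.range N', k n :=
      Finset.single_le_sum (fun _ _ => zero_le) (Finset.mem_range.mpr hlt)
    exact mul_le_mul' (ENNReal.coe_le_coe.mpr (hle.trans (le_add_of_nonneg_right zero_le))) le_rfl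
  · refine ((hcomp.isMicroDoubling_radialMeasure (ae_hasDerivAt_primitive_of_pos hgi) hw
      (hN'.trans hge) (hpow n hge)).2 x R hR).trans ?_
    exact mul_le_mul' (ENNReal.coe_le_coe.mpr (le_add_of_nonneg_left zero_le)) le_rfl

theorem theorem3p12 :
    (∀ (w₀ : ℝ≥0 → ℝ≥0), Measurable w₀ →
      ∀ N : ℕ, 1 ≤ N →
        (∀ n : ℕ, N ≤ n → IsNondegenerateRadon (radialMeasure w₀ n)) →
          (UniformlyStrongMicroDoubling w₀ N ↔ UniformlyWeaklyDoubling w₀ N)) ∧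
    (∀ β : ℝ≥0, 1 ≤ β →
      ∃ (N : ℕ) (K : ℝ≥0), 1 ≤ N ∧ 0 < K ∧
        ∀ (w₀ : ℝ≥0 → ℝ≥0), Measurable w₀ →
          ∀ d : ℕ, 1 ≤ d → EssConstOnDyadicAnnuli d w₀ β →
            ∀ n : ℕ, N ≤ n →
              IsLocallyFiniteMeasure (radialMeasure w₀ n) ∧
                IsMicroDoubling (n : ℝ) (radialMeasure w₀ n) K) := by
  refine ⟨fun w₀ hw N hN hrad => ⟨?_, fun h =>
    h.uniformlyStrongMicroDoubling hw hN (hrad N le_rfl).locallyFinite⟩, fun β hβ => ?_⟩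
  · rintro ⟨_, K₁, _, hK₁, h⟩
    exact ⟨K₁, hK₁, fun n hn => (h n hn).2⟩
  · obtain ⟨N, hN, hpow⟩ := exists_two_mul_sq_le_two_pow β
    have hβ0 : 0 < β := one_pos.trans_le hβ
    refine ⟨N, 3 * β + 2 * β ^ 6, by omega, by positivity, fun w₀ hw d hd hw₀ n hn => ?_⟩
    obtain ⟨L, hL, hC⟩ := hw₀.comparableOn hd hw
    exact hC.isMicroDoubling_radialMeasure hL hw (hN.trans hn) (hpow n hn)
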